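/- Let $X$ be an irreducible Markov chain on a finite state space $S$ with transition matrix $P$ and stationary distribution $\pi$. Write $\|\mu-\nu\|=\frac12\sum_{y}|\mu(y)-\nu(y)|$ for total variation distance. Let $P_L=\frac{P+I}{2}$ and define the lazy mixing time $$t_{\mathrm L}=\min\Big\{t\in\{0,1,2,\dots\}:\ \max_{x\in S}\|P_L^t(x,\cdot)-\pi\|\le \tfrac14\Big\}.$$ For each integer $t\ge 1$ let $Z_t$ be a geometric random variable with values in $\{1,2,\dots\}$ and success probability $1/t$ (so of mean $t$), independent of the chain, and let $Z_0=0$. Define the geometric mixing time $$t_{\mathrm G}=\min\Big\{t\in\{0,1,2,\dots\}:\ \max_{x\in S}\|\mathbb P_x(X_{Z_t}=\cdot)-\pi\|\le \tfrac14\Big\}.$$ **Theorem.** There are universal constants $c,c'>0$ such that for every irreducible finite chain that is reversible, i.e. $\pi(x)P(x,y)=\pi(y)P(y,x)$ for all $x,y\in S$, both minima exist and $$c\,t_{\mathrm G}\le t_{\mathrm L}\le c'\,t_{\mathrm G}.$$ -/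

import Mathlib

noncomputable section

namespace MarkovMixing

/-- `P` is the transition matrix of an irreducible Markov chain on the finite state space `S`, and
`π` is its stationary distribution. -/
structure IsIrreducibleChain {S : Type*} [Fintype S] [DecidableEq S]
    (P : Matrix S S ℝ) (π : S → ℝ) : Prop where
  stochastic : P ∈ Matrix.rowStochastic ℝ S
  irreducible : P.IsIrreducible
  isProb : π ∈ stdSimplex ℝ S
  stationary : Matrix.vecMul π P = π

/-- Detailed balance: `P` is reversible with respect to `π`. -/
def IsReversible {S : Type*} (P : Matrix S S ℝ) (π : S → ℝ) : Prop :=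
  ∀ x y, π x * P x y = π y * P y x

/-- Total variation distance between two probability vectors on a finite set. -/
def tvDist {S : Type*} [Fintype S] (μ ν : S → ℝ) : ℝ :=
  (1 / 2) * ∑ y, |μ y - ν y|

/-- Transition matrix `(P + I) / 2` of the lazy version of the chain. -/
def lazyMatrix {S : Type*} [DecidableEq S] (P : Matrix S S ℝ) : Matrix S S ℝ :=
  (1 / 2 : ℝ) • (P + 1)

/-- `d_L(t) = max_x ‖P_L ^ t (x, ·) - π‖`. -/
def lazyDist {S : Type*} [Fintype S] [DecidableEq S]
    (P : Matrix S S ℝ) (π : S → ℝ) (t : ℕ) : ℝ :=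
  ⨆ x, tvDist ((lazyMatrix P ^ t) x) π

/-- The lazy mixing time `t_L = min {t ≥ 0 : d_L(t) ≤ 1/4}`. -/
def lazyMixingTime {S : Type*} [Fintype S] [DecidableEq S]
    (P : Matrix S S ℝ) (π : S → ℝ) : ℕ :=
  sInf {t | lazyDist P π t ≤ 1 / 4}

/-- The law `k ↦ ℙ(Z_t = k)` of a geometric random variable on `{1, 2, …}` of mean `t` and success
probability `1 / t`. For `t = 0` it is the unit mass at `0`, the only law on `ℕ` of mean `0`. -/
def geometricLaw (t k : ℕ) : ℝ :=
  if t = 0 then (if k = 0 then 1 else 0)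
  else if k = 0 then 0
  else (1 - 1 / (t : ℝ)) ^ (k - 1) * (1 / (t : ℝ))

/-- The law `y ↦ ℙ_x(X_N = y)` of the chain started at `x` and sampled at a random time `N`
independent of the chain, where `ν k = ℙ(N = k)`. -/
def lawAtIndepTime {S : Type*} [Fintype S] [DecidableEq S]
    (P : Matrix S S ℝ) (ν : ℕ → ℝ) (x y : S) : ℝ :=
  ∑' k : ℕ, ν k * (P ^ k) x y

/-- `d_G(t) = max_x ‖ℙ_x(X_{Z_t} = ·) - π‖`. -/
def geometricDist {S : Type*} [Fintype S] [DecidableEq S]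
    (P : Matrix S S ℝ) (π : S → ℝ) (t : ℕ) : ℝ :=
  ⨆ x, tvDist (lawAtIndepTime P (geometricLaw t) x) π

/-- The geometric mixing time `t_G = min {t ≥ 0 : d_G(t) ≤ 1/4}`. -/
def geometricMixingTime {S : Type*} [Fintype S] [DecidableEq S]
    (P : Matrix S S ℝ) (π : S → ℝ) : ℕ :=
  sInf {t | geometricDist P π t ≤ 1 / 4}

end MarkovMixing

end

/-! Write L for the lazy version of P and p for the matrix with all rows π. In the operator norm
given by the largest absolute row sum, total variation distance at most 1/4 from every start means
norm distance at most 1/2 from p.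

The link between the two times is a resolvent identity. If k ≥ 0 is geometric of ratio θ, the
average of P^k and P^(k+1) is again a geometric average of powers of L, of ratio σ = 2θ/(1+θ). Hence
mixing of L at a fixed time passes to the geometric average, by waiting until a much longer
geometric time exceeds it (`norm_geometricAverage_sub_le`). This direction does not use
reversibility.

Conversely, truncating the geometric average in L and taking a power gives a polynomial average of L
of degree O(t), as close to p as needed (`exists_polynomial_norm_aeval_lazyVersion_sub_le`). To
replace this random time by a fixed one, reversibility enters: L is self-adjoint on L²(π) with
spectrum in [0,1], so L^s(1-L) has L²(π) norm at most 1/(s+1). Thus L^m f hardly changes, on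
π-average, when m moves by a small fraction (`norm_pow_sub_constantRows_le`). -/

open Matrix Finset

namespace MarkovMixing

/-! ### Powers and geometric averages of a contraction in a Banach algebra. -/

section BanachAlgebra

variable {𝔸 : Type*} [NormedRing 𝔸] [NormedAlgebra ℝ 𝔸]

/-- If `M` absorbs an idempotent `p` and `M = E + b p`, then the powers of `M` approach `p` at the
rate of the powers of `E`. -/
theorem pow_sub_eq_of_eq_add_smul {p M E : 𝔸} {b : ℝ} (hp : p * p = p) (hMp : M * p = p)
    (hpM : p * M = p) (hM : M = E + b • p) (j : ℕ) : M ^ j - p = E ^ j * (1 - p) := by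
  have h : M - p = E * (1 - p) := by
    have hE : E = M - b • p := by rw [hM]; abel
    rw [hE, sub_mul, mul_sub, mul_sub, hMp, smul_mul_assoc, smul_mul_assoc, hp]
    simp
  have h' : (1 - p) * M = E * (1 - p) := by rw [sub_mul, one_mul, hpM, h]
  induction j with
  | zero => simp
  | succ j ih =>
    have : M ^ (j + 1) - p = (M ^ j - p) * M := by rw [sub_mul, hpM, pow_succ]
    rw [this, ih, mul_assoc, h', ← mul_assoc, pow_succ]

/-- Amplification: once a multiple of p is split off with a remainder of norm below 1, convergence
is exponential. The factor 2 bounds ‖1 - p‖. -/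
theorem norm_pow_sub_le [NormOneClass 𝔸] {p M E : 𝔸} {b : ℝ} (hp : p * p = p) (hMp : M * p = p)
    (hpM : p * M = p) (hM : M = E + b • p) (hpn : ‖p‖ ≤ 1) (j : ℕ) :
    ‖M ^ j - p‖ ≤ 2 * ‖E‖ ^ j := by
  rw [pow_sub_eq_of_eq_add_smul hp hMp hpM hM]
  have h1 : ‖(1 : 𝔸) - p‖ ≤ 2 := (norm_sub_le _ _).trans (by rw [norm_one]; linarith)
  calc ‖E ^ j * (1 - p)‖ ≤ ‖E ^ j‖ * ‖1 - p‖ := norm_mul_le _ _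
    _ ≤ ‖E‖ ^ j * 2 := by gcongr; exact norm_pow_le _ _
    _ = _ := mul_comm _ _

theorem norm_pow_le_one {𝔸 : Type*} [NormedRing 𝔸] [NormOneClass 𝔸] {P : 𝔸}
    (hP : ‖P‖ ≤ 1) (k : ℕ) : ‖P ^ k‖ ≤ 1 :=
  (norm_pow_le _ _).trans (pow_le_one₀ (norm_nonneg _) hP)

/-- The average of the powers `P, P ^ 2, …` with geometric weights of ratio `θ`. -/
noncomputable def geometricAverage (P : 𝔸) (θ : ℝ) : 𝔸 :=
  ∑' k : ℕ, ((1 - θ) * θ ^ k) • P ^ (k + 1)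

section GeometricAverage

variable [NormOneClass 𝔸] {P p : 𝔸} {θ : ℝ}

theorem hasSum_geometricWeight (h0 : 0 ≤ θ) (h1 : θ < 1) :
    HasSum (fun k : ℕ => (1 - θ) * θ ^ k) 1 := by
  have := (hasSum_geometric_of_lt_one h0 h1).mul_left (1 - θ)
  rwa [mul_inv_cancel₀ (by linarith)] at this

theorem norm_geometricTerm_le (h0 : 0 ≤ θ) (h1 : θ < 1) (hP : ‖P‖ ≤ 1) (k : ℕ) :
    ‖((1 - θ) * θ ^ k) • P ^ (k + 1)‖ ≤ (1 - θ) * θ ^ k := by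
  have h : 0 ≤ (1 - θ) * θ ^ k := mul_nonneg (by linarith) (pow_nonneg h0 _)
  rw [norm_smul, Real.norm_of_nonneg h]
  exact mul_le_of_le_one_right h (norm_pow_le_one hP _)

theorem norm_geometricAverage_le_one (h0 : 0 ≤ θ) (h1 : θ < 1) (hP : ‖P‖ ≤ 1) :
    ‖geometricAverage P θ‖ ≤ 1 :=
  tsum_of_norm_bounded (hasSum_geometricWeight h0 h1) (norm_geometricTerm_le h0 h1 hP)

variable [CompleteSpace 𝔸]

theorem hasSum_geometricAverage (h0 : 0 ≤ θ) (h1 : θ < 1) (hP : ‖P‖ ≤ 1) :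
    HasSum (fun k : ℕ => ((1 - θ) * θ ^ k) • P ^ (k + 1)) (geometricAverage P θ) :=
  (Summable.of_norm_bounded (hasSum_geometricWeight h0 h1).summable
    (norm_geometricTerm_le h0 h1 hP)).hasSum

theorem geometricAverage_mul (h0 : 0 ≤ θ) (h1 : θ < 1) (hP : ‖P‖ ≤ 1) (h : P * p = p) :
    geometricAverage P θ * p = p := by
  have hk : ∀ k : ℕ, P ^ k * p = p := fun k => by
    induction k with
    | zero => simp
    | succ k ih => rw [pow_succ, mul_assoc, h, ih]
  have h2 := (hasSum_geometricAverage h0 h1 hP).mul_right p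
  have h3 := (hasSum_geometricWeight h0 h1).smul_const p
  simp only [smul_mul_assoc, hk] at h2
  simpa using h2.unique h3

theorem mul_geometricAverage (h0 : 0 ≤ θ) (h1 : θ < 1) (hP : ‖P‖ ≤ 1) (h : p * P = p) :
    p * geometricAverage P θ = p := by
  have hk : ∀ k : ℕ, p * P ^ k = p := fun k => by
    induction k with
    | zero => simp
    | succ k ih => rw [pow_succ, ← mul_assoc, ih, h]
  have h2 := (hasSum_geometricAverage h0 h1 hP).mul_left p
  have h3 := (hasSum_geometricWeight h0 h1).smul_const p
  simp only [mul_smul_comm, hk] at h2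
  simpa using h2.unique h3

theorem geometricAverage_eq (h0 : 0 ≤ θ) (h1 : θ < 1) (hP : ‖P‖ ≤ 1) :
    geometricAverage P θ = (1 - θ) • P + θ • (P * geometricAverage P θ) := by
  have h := hasSum_geometricAverage h0 h1 hP
  have h2 := (h.mul_left P).const_smul θ
  have h3 := (hasSum_nat_add_iff' (f := fun k : ℕ => ((1 - θ) * θ ^ k) • P ^ (k + 1)) 1).2 h
  have h4 : (fun k : ℕ => ((1 - θ) * θ ^ (k + 1)) • P ^ (k + 1 + 1)) =
      fun k : ℕ => θ • (P * ((1 - θ) * θ ^ k) • P ^ (k + 1)) := by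
    funext k
    rw [mul_smul_comm, smul_smul, pow_succ' P (k + 1), pow_succ' θ]
    congr 1
    ring
  rw [h4] at h3
  have h5 := h3.unique h2
  simp only [sum_range_one, pow_zero, mul_one, zero_add, pow_one] at h5
  rw [← h5]
  abel

end GeometricAverage

/-! ### From geometric averages of P to geometric averages of its lazy version. -/

/-- The lazy version `(P + 1) / 2` of `P`. -/
noncomputable def lazyVersion (P : 𝔸) : 𝔸 := (1 / 2 : ℝ) • (P + 1)

/-- The average of `P ^ k` and `P ^ (k + 1)` over a geometric time `k ≥ 0`: a geometric average of
the powers of the lazy version of `P`. -/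
noncomputable def lazyGeometricAverage (P : 𝔸) (θ : ℝ) : 𝔸 :=
  ((1 - θ) / 2) • (1 : 𝔸) + ((1 + θ) / 2) • geometricAverage P θ

/-- Memorylessness: iterating the resolvent equation n times leaves the tail of the geometric time
as a fresh copy of G started after n steps. -/
theorem eq_sum_add_of_eq_smul_add {L G : 𝔸} {σ : ℝ} (h : G = (1 - σ) • L + σ • (L * G)) (n : ℕ) :
    G = ∑ k ∈ range n, ((1 - σ) * σ ^ k) • L ^ (k + 1) + σ ^ n • (L ^ n * G) := by
  induction n with
  | zero => simp
  | succ n ih =>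
    have : σ ^ n • (L ^ n * G) =
        ((1 - σ) * σ ^ n) • L ^ (n + 1) + σ ^ (n + 1) • (L ^ (n + 1) * G) := by
      conv_lhs => rw [h]
      rw [mul_add, mul_smul_comm, mul_smul_comm, ← mul_assoc, ← pow_succ, smul_add, smul_smul,
        smul_smul, mul_comm (σ ^ n), ← pow_succ]
    rw [sum_range_succ, add_assoc, ← this]
    exact ih

theorem sum_range_geometricWeight (σ : ℝ) (n : ℕ) :
    ∑ k ∈ range n, (1 - σ) * σ ^ k = 1 - σ ^ n := by
  rw [← mul_sum, mul_comm, geom_sum_mul_neg]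

section LazyGeometricAverage

theorem norm_lazyVersion_le_one [NormOneClass 𝔸] {P : 𝔸} (hP : ‖P‖ ≤ 1) :
    ‖lazyVersion P‖ ≤ 1 := by
  rw [lazyVersion, norm_smul]
  have := norm_add_le P 1
  rw [norm_one] at this
  norm_num
  linarith

theorem lazyVersion_mul {P p : 𝔸} (h : P * p = p) : lazyVersion P * p = p := by
  rw [lazyVersion, smul_mul_assoc, add_mul, h, one_mul, ← two_smul ℝ, smul_smul]
  norm_num

theorem mul_lazyVersion {P p : 𝔸} (h : p * P = p) : p * lazyVersion P = p := by
  rw [lazyVersion, mul_smul_comm, mul_add, h, mul_one, ← two_smul ℝ, smul_smul]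
  norm_num

variable [NormOneClass 𝔸] {P p : 𝔸} {θ : ℝ}

theorem norm_lazyGeometricAverage_le_one (h0 : 0 ≤ θ) (h1 : θ < 1) (hP : ‖P‖ ≤ 1) :
    ‖lazyGeometricAverage P θ‖ ≤ 1 := by
  refine (norm_add_le _ _).trans ?_
  rw [norm_smul, norm_smul, norm_one, Real.norm_of_nonneg (by linarith),
    Real.norm_of_nonneg (by linarith)]
  have := norm_geometricAverage_le_one h0 h1 hP
  nlinarith

variable [CompleteSpace 𝔸]

theorem lazyGeometricAverage_mul (h0 : 0 ≤ θ) (h1 : θ < 1) (hP : ‖P‖ ≤ 1) (h : P * p = p) :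
    lazyGeometricAverage P θ * p = p := by
  rw [lazyGeometricAverage, add_mul, smul_mul_assoc, smul_mul_assoc,
    geometricAverage_mul h0 h1 hP h, one_mul, ← add_smul]
  ring_nf
  simp

theorem mul_lazyGeometricAverage (h0 : 0 ≤ θ) (h1 : θ < 1) (hP : ‖P‖ ≤ 1) (h : p * P = p) :
    p * lazyGeometricAverage P θ = p := by
  rw [lazyGeometricAverage, mul_add, mul_smul_comm, mul_smul_comm,
    mul_geometricAverage h0 h1 hP h, mul_one, ← add_smul]
  ring_nf
  simp

/-- With P = 2L - 1 one has 1 - θP = (1 + θ)(1 - σL), so (1 - θ)L(1 - θP)⁻¹ = (1 - σ)L(1 - σL)⁻¹. -/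
theorem lazyGeometricAverage_eq (h0 : 0 ≤ θ) (h1 : θ < 1) (hP : ‖P‖ ≤ 1) {σ : ℝ}
    (hσ : σ * (1 + θ) = 2 * θ) :
    lazyGeometricAverage P θ =
      (1 - σ) • lazyVersion P + σ • (lazyVersion P * lazyGeometricAverage P θ) := by
  have hR := geometricAverage_eq h0 h1 hP
  set R := geometricAverage P θ with hRdef
  have hne : (1 + θ) ≠ 0 := by linarith
  have hPR : θ • (P * R) = R - (1 - θ) • P := by rw [eq_sub_iff_add_eq, add_comm]; exact hR.symm
  have hs : σ = 2 * θ / (1 + θ) := by rw [eq_div_iff hne, hσ]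
  have key : (1 + θ) • lazyGeometricAverage P θ = (1 + θ) • ((1 - σ) • lazyVersion P +
      σ • (lazyVersion P * lazyGeometricAverage P θ)) := by
    have e1 : (1 + θ) • ((1 - σ) • lazyVersion P +
        σ • (lazyVersion P * lazyGeometricAverage P θ)) = (1 - θ) • lazyVersion P +
        (2 * θ) • (lazyVersion P * lazyGeometricAverage P θ) := by
      rw [smul_add, smul_smul, smul_smul, mul_comm (1 + θ) σ, hσ]
      congr 2
      linarith
    have e2 : (2 * θ) • (lazyVersion P * lazyGeometricAverage P θ) =
        (θ * (1 - θ) / 2) • P + (θ * (1 - θ) / 2) • (1 : 𝔸) +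
        ((1 + θ) / 2) • (θ • (P * R)) + (θ * (1 + θ) / 2) • R := by
      simp only [lazyVersion, lazyGeometricAverage, ← hRdef, smul_mul_assoc, mul_add, add_mul,
        mul_smul_comm, one_mul, mul_one]
      module
    rw [e1, e2, hPR]
    simp only [lazyVersion, lazyGeometricAverage, ← hRdef]
    module
  have := congrArg (fun x => (1 + θ)⁻¹ • x) key
  simpa only [smul_smul, inv_mul_cancel₀ hne, one_smul] using this

end LazyGeometricAverage

/-- A geometric average of powers, with the tail after time `n` moved to time `n`. -/
noncomputable def truncatedGeometric (σ : ℝ) (n : ℕ) : Polynomial ℝ :=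
  ∑ k ∈ range n, Polynomial.monomial (k + 1) ((1 - σ) * σ ^ k) + Polynomial.monomial n (σ ^ n)

theorem aeval_truncatedGeometric (σ : ℝ) (n : ℕ) (L : 𝔸) :
    Polynomial.aeval L (truncatedGeometric σ n) =
      ∑ k ∈ range n, ((1 - σ) * σ ^ k) • L ^ (k + 1) + σ ^ n • L ^ n := by
  simp only [truncatedGeometric, map_add, map_sum, Polynomial.aeval_monomial,
    Algebra.smul_def]

theorem eval_one_truncatedGeometric (σ : ℝ) (n : ℕ) : (truncatedGeometric σ n).eval 1 = 1 := by
  simp [truncatedGeometric, Polynomial.eval_finsetSum, sum_range_geometricWeight]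

theorem coeff_truncatedGeometric_nonneg {σ : ℝ} (h0 : 0 ≤ σ) (h1 : σ ≤ 1) (n k : ℕ) :
    0 ≤ (truncatedGeometric σ n).coeff k := by
  simp only [truncatedGeometric, Polynomial.coeff_add, Polynomial.finsetSum_coeff,
    Polynomial.coeff_monomial]
  have : ∀ k, 0 ≤ σ ^ k := fun k => pow_nonneg h0 k
  refine add_nonneg (sum_nonneg fun i _ => ?_) ?_
  · split_ifs
    · exact mul_nonneg (by linarith) (this _)
    · exact le_rfl
  · split_ifs
    · exact this _
    · exact le_rfl

theorem natDegree_truncatedGeometric_le (σ : ℝ) (n : ℕ) :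
    (truncatedGeometric σ n).natDegree ≤ n := by
  refine Polynomial.natDegree_add_le_of_degree_le ?_ (Polynomial.natDegree_monomial_le _)
  refine Polynomial.natDegree_sum_le_of_forall_le _ _ fun k hk => ?_
  exact (Polynomial.natDegree_monomial_le _).trans (mem_range.1 hk)

theorem coeff_pow_nonneg {q : Polynomial ℝ} (hq : ∀ k, 0 ≤ q.coeff k) (j k : ℕ) :
    0 ≤ (q ^ j).coeff k := by
  induction j generalizing k with
  | zero => rw [pow_zero, Polynomial.coeff_one]; split_ifs <;> norm_num
  | succ j ih =>
    rw [pow_succ, Polynomial.coeff_mul]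
    exact sum_nonneg fun x _ => mul_nonneg (ih _) (hq _)

/-! ### Quantitative comparison of lazy powers with geometric averages. -/

section Comparison

variable [NormOneClass 𝔸] {P p : 𝔸}

/-- If `L ^ n` is close to `p`, then so is the geometric average of the powers of `L`. -/
theorem norm_sub_le_of_eq_smul_add {L G : 𝔸} {σ δ : ℝ} (hσ0 : 0 ≤ σ) (hσ1 : σ ≤ 1)
    (h : G = (1 - σ) • L + σ • (L * G)) (hL : ‖L‖ ≤ 1) (hG : ‖G‖ ≤ 1) (hp : ‖p‖ ≤ 1)
    (hpG : p * G = p) {n : ℕ} (hn : ‖L ^ n - p‖ ≤ δ) :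
    ‖G - p‖ ≤ 2 * (n * (1 - σ)) + δ := by
  have e : G - p = ∑ k ∈ range n, ((1 - σ) * σ ^ k) • (L ^ (k + 1) - p) +
      σ ^ n • ((L ^ n - p) * G) := by
    conv_lhs => rw [eq_sum_add_of_eq_smul_add h n]
    simp only [smul_sub, sum_sub_distrib]
    rw [← sum_smul, sum_range_geometricWeight, sub_mul, hpG]
    module
  have hσn : σ ^ n ≤ 1 := pow_le_one₀ hσ0 hσ1
  have hσn0 : 0 ≤ σ ^ n := pow_nonneg hσ0 n
  have hδ : 0 ≤ δ := (norm_nonneg _).trans hn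
  have b1 : ‖∑ k ∈ range n, ((1 - σ) * σ ^ k) • (L ^ (k + 1) - p)‖ ≤ 2 * (1 - σ ^ n) := by
    rw [← sum_range_geometricWeight, mul_sum]
    refine (norm_sum_le _ _).trans (sum_le_sum fun k _ => ?_)
    have hw : 0 ≤ (1 - σ) * σ ^ k := mul_nonneg (by linarith) (pow_nonneg hσ0 _)
    rw [norm_smul, Real.norm_of_nonneg hw, mul_comm 2]
    refine mul_le_mul_of_nonneg_left ((norm_sub_le _ _).trans ?_) hw
    linarith [norm_pow_le_one hL (k + 1)]
  have b2 : ‖σ ^ n • ((L ^ n - p) * G)‖ ≤ δ := by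
    rw [norm_smul, Real.norm_of_nonneg hσn0]
    have : ‖(L ^ n - p) * G‖ ≤ δ * 1 :=
      (norm_mul_le _ _).trans (mul_le_mul hn hG (norm_nonneg _) hδ)
    nlinarith [norm_nonneg ((L ^ n - p) * G)]
  have b3 : 1 - σ ^ n ≤ n * (1 - σ) := by
    have := one_add_mul_le_pow (a := σ - 1) (by linarith) n
    rw [add_sub_cancel] at this
    linarith
  rw [e]
  linarith [norm_add_le (∑ k ∈ range n, ((1 - σ) * σ ^ k) • (L ^ (k + 1) - p))
    (σ ^ n • ((L ^ n - p) * G))]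

variable [CompleteSpace 𝔸]

/-- If the powers of the lazy version of `P` are close to `p` at time `t ≥ 1`, then so is the
geometric average of the powers of `P` of mean `32 t + 1`. -/
theorem norm_geometricAverage_sub_le (hP : ‖P‖ ≤ 1) (hp : ‖p‖ ≤ 1) (hpp : p * p = p)
    (hPp : P * p = p) (hpP : p * P = p) {t : ℕ} (ht : 1 ≤ t)
    (h : ‖lazyVersion P ^ t - p‖ ≤ 1 / 2) :
    ‖geometricAverage P (1 - 1 / ((32 * t + 1 : ℕ) : ℝ)) - p‖ ≤ 1 / 2 := by
  have htR : (1 : ℝ) ≤ t := by exact_mod_cast ht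
  set T : ℝ := ((32 * t + 1 : ℕ) : ℝ) with hT
  have hT' : T = 32 * t + 1 := by rw [hT]; push_cast; ring
  have hT0 : 33 ≤ T := by linarith
  have hinv : 1 / T ≤ 1 / 33 := one_div_le_one_div_of_le (by norm_num) hT0
  have hinv0 : 0 < 1 / T := by positivity
  set θ : ℝ := 1 - 1 / T with hθ
  have h0 : 0 ≤ θ := by linarith
  have h1 : θ < 1 := by linarith
  -- Here 1 - σ = (1 - θ)/(1 + θ) = 1/(2T - 1), which is 1/(64t + 1).
  have hσe : (1 - 1 / (2 * T - 1)) * (1 + θ) = 2 * θ := by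
    rw [hθ]; field_simp [show 2 * T - 1 ≠ 0 by linarith]; ring
  have hσ0 : 0 ≤ 1 - 1 / (2 * T - 1) := by
    rw [sub_nonneg, div_le_one] <;> linarith
  have hσ1 : 1 - 1 / (2 * T - 1) ≤ 1 := by
    have : 0 ≤ 1 / (2 * T - 1) := by apply div_nonneg <;> linarith
    linarith
  have hLp : ∀ k : ℕ, lazyVersion P ^ k * p = p ∧ p * lazyVersion P ^ k = p := fun k => by
    induction k with
    | zero => simp
    | succ k ih =>
      exact ⟨by rw [pow_succ, mul_assoc, lazyVersion_mul hPp, ih.1],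
        by rw [pow_succ, ← mul_assoc, ih.2, mul_lazyVersion hpP]⟩
  -- Four blocks of length t give 2 · (1/2)^4. The geometric time stops within these 4t steps with
  -- probability at most 1/16, so in total ‖G - p‖ ≤ 2/16 + 1/8 = 1/4.
  have h4 : ‖lazyVersion P ^ (t * 4) - p‖ ≤ 1 / 8 := by
    have := norm_pow_sub_le (M := lazyVersion P ^ t) (E := lazyVersion P ^ t - p) (b := 1) hpp
      (hLp t).1 (hLp t).2 (by simp) hp 4
    rw [← pow_mul] at this
    refine this.trans ?_
    have := pow_le_pow_left₀ (norm_nonneg _) h 4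
    norm_num at this ⊢
    linarith
  have hG := norm_sub_le_of_eq_smul_add hσ0 hσ1 (lazyGeometricAverage_eq h0 h1 hP hσe)
    (norm_lazyVersion_le_one hP) (norm_lazyGeometricAverage_le_one h0 h1 hP) hp
    (mul_lazyGeometricAverage h0 h1 hP hpP) h4
  have hq : ((t * 4 : ℕ) : ℝ) * (1 - (1 - 1 / (2 * T - 1))) ≤ 1 / 16 := by
    rw [sub_sub_cancel, mul_one_div, div_le_iff₀ (by linarith)]
    push_cast
    linarith
  have e : ((1 + θ) / 2) • (geometricAverage P θ - p) =
      (lazyGeometricAverage P θ - p) - ((1 - θ) / 2) • (1 - p) := by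
    rw [lazyGeometricAverage]
    module
  have hn := congrArg norm e
  rw [norm_smul, Real.norm_of_nonneg (by linarith)] at hn
  have h5 := norm_sub_le (lazyGeometricAverage P θ - p) (((1 - θ) / 2) • (1 - p))
  rw [← hn, norm_smul, Real.norm_of_nonneg (by linarith)] at h5
  have h6 : ‖(1 : 𝔸) - p‖ ≤ 2 := (norm_sub_le _ _).trans (by rw [norm_one]; linarith)
  nlinarith [norm_nonneg (geometricAverage P θ - p)]

/-- If the geometric average of the powers of `P` of mean `t ≥ 1` is close to `p`, then some
average of the first `200 t` powers of the lazy version of `P` is closer to `p`. -/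
theorem exists_polynomial_norm_aeval_lazyVersion_sub_le (hP : ‖P‖ ≤ 1) (hp : ‖p‖ ≤ 1)
    (hpp : p * p = p) (hPp : P * p = p) (hpP : p * P = p) {t : ℕ} (ht : 1 ≤ t)
    (h : ‖geometricAverage P (1 - 1 / (t : ℝ)) - p‖ ≤ 1 / 2) :
    ∃ q : Polynomial ℝ, (∀ k, 0 ≤ q.coeff k) ∧ q.eval 1 = 1 ∧ q.natDegree ≤ 200 * t ∧
      ‖Polynomial.aeval (lazyVersion P) q - p‖ ≤ 1 / 12 := by
  have hT : (1 : ℝ) ≤ t := by exact_mod_cast ht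
  have hinv0 : 0 < 1 / (t : ℝ) := by positivity
  have hinv1 : 1 / (t : ℝ) ≤ 1 := by rw [div_le_one] <;> linarith
  set θ : ℝ := 1 - 1 / (t : ℝ) with hθ
  have h0 : 0 ≤ θ := by linarith
  have h1 : θ < 1 := by linarith
  set σ : ℝ := 1 - 1 / (2 * t - 1) with hσ
  have hσe : σ * (1 + θ) = 2 * θ := by
    rw [hσ, hθ]; field_simp [show 2 * (t : ℝ) - 1 ≠ 0 by linarith]; ring
  have hσ0 : 0 ≤ σ := by
    rw [hσ, sub_nonneg, div_le_one] <;> linarith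
  have hσ1 : σ ≤ 1 := by
    have : 0 ≤ 1 / (2 * (t : ℝ) - 1) := by apply div_nonneg <;> linarith
    linarith
  -- σ^(8t) ≤ exp(-8t/(2t - 1)) ≤ exp(-4).
  have hσn : σ ^ (8 * t) ≤ 1 / 16 := by
    have h2 : σ ≤ Real.exp (-(1 / (2 * t - 1))) := by
      have := Real.add_one_le_exp (-(1 / (2 * (t : ℝ) - 1)))
      linarith
    have h3 : σ ^ (8 * t) ≤ Real.exp (-4) := by
      refine (pow_le_pow_left₀ hσ0 h2 _).trans ?_
      rw [← Real.exp_nat_mul, Real.exp_le_exp, mul_neg, neg_le_neg_iff, mul_one_div,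
        le_div_iff₀ (by linarith)]
      push_cast
      linarith
    have h4 : Real.exp (-4) ≤ 1 / 16 := by
      rw [Real.exp_neg, ← one_div]
      refine one_div_le_one_div_of_le (by norm_num) ?_
      have h5 : (2 : ℝ) ≤ Real.exp 1 := by linarith [Real.add_one_le_exp (1 : ℝ)]
      have h6 := pow_le_pow_left₀ (by norm_num) h5 4
      rw [← Real.exp_nat_mul] at h6
      norm_num at h6
      linarith
    exact h3.trans h4
  set L := lazyVersion P with hLdef
  have hL := norm_lazyVersion_le_one hP
  have hLp : ∀ k : ℕ, L ^ k * p = p ∧ p * L ^ k = p := fun k => by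
    induction k with
    | zero => simp
    | succ k ih =>
      exact ⟨by rw [pow_succ, mul_assoc, lazyVersion_mul hPp, ih.1],
        by rw [pow_succ, ← mul_assoc, ih.2, mul_lazyVersion hpP]⟩
  set G := lazyGeometricAverage P θ with hG
  have hGn : ‖G‖ ≤ 1 := norm_lazyGeometricAverage_le_one h0 h1 hP
  set n := 8 * t with hn
  set A := Polynomial.aeval L (truncatedGeometric σ n) with hA
  -- Truncation replaces the final factor G of the tail by 1.
  have hAG : A - G = σ ^ n • (L ^ n * (1 - G)) := by
    have := eq_sum_add_of_eq_smul_add (lazyGeometricAverage_eq h0 h1 hP hσe) n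
    rw [← hLdef, ← hG] at this
    rw [hA, aeval_truncatedGeometric]
    nth_rewrite 1 [this]
    rw [mul_sub, smul_sub, mul_one]
    abel
  have hAGn : ‖A - G‖ ≤ 1 / 8 := by
    rw [hAG, norm_smul, Real.norm_of_nonneg (pow_nonneg hσ0 _)]
    have h2 : ‖L ^ n * (1 - G)‖ ≤ 1 * 2 := by
      refine (norm_mul_le _ _).trans (mul_le_mul (norm_pow_le_one hL n) ?_ (norm_nonneg _)
        zero_le_one)
      refine (norm_sub_le _ _).trans ?_
      rw [norm_one]
      linarith
    nlinarith [pow_nonneg hσ0 n, norm_nonneg (L ^ n * (1 - G))]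
  have hGp : G * p = p := lazyGeometricAverage_mul h0 h1 hP hPp
  have hpG : p * G = p := mul_lazyGeometricAverage h0 h1 hP hpP
  have hAp : A * p = p := by
    have : (A - G) * p = 0 := by
      rw [hAG, smul_mul_assoc, mul_assoc, sub_mul, one_mul, hGp, sub_self, mul_zero, smul_zero]
    rw [sub_mul, hGp, sub_eq_zero] at this
    exact this
  have hpA : p * A = p := by
    have : p * (A - G) = 0 := by
      rw [hAG, mul_smul_comm, ← mul_assoc, (hLp n).2, mul_sub, mul_one, hpG, sub_self, smul_zero]
    rw [mul_sub, hpG, sub_eq_zero] at this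
    exact this
  set E := (A - G) + (((1 - θ) / 2) • (1 : 𝔸) + ((1 + θ) / 2) • (geometricAverage P θ - p)) with hE
  have hAE : A = E + ((1 + θ) / 2) • p := by
    rw [hE, hG, lazyGeometricAverage]
    module
  -- The three pieces add up to 1/8 + (1 - θ)/2 + (1 + θ)/4 = 7/8 - θ/4.
  have hEn : ‖E‖ ≤ 7 / 8 := by
    have h2 := norm_add_le (A - G)
      (((1 - θ) / 2) • (1 : 𝔸) + ((1 + θ) / 2) • (geometricAverage P θ - p))
    have h3 := norm_add_le (((1 - θ) / 2) • (1 : 𝔸)) (((1 + θ) / 2) • (geometricAverage P θ - p))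
    rw [norm_smul, norm_smul, norm_one, Real.norm_of_nonneg (by linarith),
      Real.norm_of_nonneg (by linarith)] at h3
    nlinarith
  -- 2 · (7/8)^25 < 1/12, and the degree is at most 25 · 8t = 200t.
  refine ⟨truncatedGeometric σ n ^ 25,
    coeff_pow_nonneg (coeff_truncatedGeometric_nonneg hσ0 hσ1 n) 25, ?_, ?_, ?_⟩
  · rw [Polynomial.eval_pow, eval_one_truncatedGeometric, one_pow]
  · refine (Polynomial.natDegree_pow_le).trans ?_
    have := natDegree_truncatedGeometric_le σ n
    omega
  · rw [map_pow]
    refine (norm_pow_sub_le hpp hAp hpA hAE hp 25).trans ?_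
    have := pow_le_pow_left₀ (norm_nonneg _) hEn 25
    norm_num at this ⊢
    linarith

end Comparison

end BanachAlgebra

/-! ### Reversibility: quadratic forms on L²(π) and smoothness of Q^s in time. -/

section Reversible

variable {S : Type*} [Fintype S] [DecidableEq S] {π : S → ℝ} {P Q : Matrix S S ℝ}

theorem diagonal_mul_eq_transpose_mul (h : IsReversible P π) :
    diagonal π * P = Pᵀ * diagonal π := by
  ext x y
  rw [diagonal_mul, mul_diagonal, transpose_apply, h x y, mul_comm]

theorem stationary_of_isReversible (hP : P ∈ rowStochastic ℝ S) (h : IsReversible P π) (y : S) :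
    ∑ x, π x * P x y = π y := by
  simp only [h _ y, ← mul_sum, sum_row_of_mem_rowStochastic hP, mul_one]

theorem dotProduct_diagonal_mulVec (f g : S → ℝ) :
    f ⬝ᵥ (diagonal π *ᵥ g) = ∑ x, π x * (f x * g x) := by
  simp only [dotProduct, mulVec_diagonal]
  exact sum_congr rfl fun x _ => by ring

/-- For `a = ± 1`, the form `⟨f, (1 + a P) f⟩_π` is half the sum of the `π x P x y (f x + a f y)²`. -/
theorem posSemidef_diagonal_mul_one_add_smul (hπ : ∀ x, 0 ≤ π x) (hP : P ∈ rowStochastic ℝ S)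
    (h : IsReversible P π) {a : ℝ} (ha : a ^ 2 = 1) :
    (diagonal π * (1 + a • P)).PosSemidef := by
  refine PosSemidef.of_dotProduct_mulVec_nonneg ?_ fun f => ?_
  · rw [IsHermitian, conjTranspose_eq_transpose_of_trivial, transpose_mul, diagonal_transpose,
      mul_add, transpose_add, transpose_smul, transpose_one, add_mul, smul_mul_assoc,
      ← diagonal_mul_eq_transpose_mul h, mul_one, one_mul, mul_smul_comm]
  · have e1 : ∑ x, ∑ y, π x * P x y * f x ^ 2 = ∑ x, π x * f x ^ 2 := by
      refine sum_congr rfl fun x _ => ?_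
      rw [← sum_mul, ← mul_sum, sum_row_of_mem_rowStochastic hP, mul_one]
    have e2 : ∑ x, ∑ y, π x * P x y * f y ^ 2 = ∑ x, π x * f x ^ 2 := by
      rw [sum_comm]
      refine sum_congr rfl fun y _ => ?_
      rw [← sum_mul, stationary_of_isReversible hP h]
    have e3 : ∑ x, ∑ y, π x * P x y * (f x + a * f y) ^ 2 =
        2 * (star f ⬝ᵥ ((diagonal π * (1 + a • P)) *ᵥ f)) := by
      have : ∀ x y, π x * P x y * (f x + a * f y) ^ 2 = π x * P x y * f x ^ 2 +
          π x * P x y * f y ^ 2 + 2 * (π x * (f x * (a * (P x y * f y)))) := fun x y => by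
        linear_combination π x * P x y * f y ^ 2 * ha
      simp only [this, sum_add_distrib, e1, e2, ← mul_sum]
      rw [star_trivial, ← mulVec_mulVec, dotProduct_diagonal_mulVec]
      have e4 : ∀ x, ((1 + a • P) *ᵥ f) x = f x + a * ∑ y, P x y * f y := fun x => by
        rw [add_mulVec, one_mulVec, smul_mulVec, Pi.add_apply, Pi.smul_apply, smul_eq_mul]
        rfl
      simp only [e4, mul_add, sum_add_distrib]
      have : ∀ x, π x * (f x * f x) = π x * f x ^ 2 := fun x => by ring
      simp only [this]
      ring
    have e5 : 0 ≤ ∑ x, ∑ y, π x * P x y * (f x + a * f y) ^ 2 :=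
      sum_nonneg fun x _ => sum_nonneg fun y _ =>
        mul_nonneg (mul_nonneg (hπ x) (hP.1 x y)) (sq_nonneg _)
    linarith

theorem posSemidef_diagonal_mul_sq_mul {N X : Matrix S S ℝ}
    (hN : diagonal π * N = Nᵀ * diagonal π) (hc : Commute N X) (hX : (diagonal π * X).PosSemidef) :
    (diagonal π * (N ^ 2 * X)).PosSemidef := by
  have := hX.conjTranspose_mul_mul_same N
  rw [conjTranspose_eq_transpose_of_trivial, ← Matrix.mul_assoc, ← hN] at this
  convert this using 1
  rw [pow_two, Matrix.mul_assoc N N X, hc.eq]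
  simp only [Matrix.mul_assoc]

/-- `Q` is symmetric for the inner product of `L²(π)`, with spectrum in `[0, 1]`. -/
structure IsPositiveContraction (Q : Matrix S S ℝ) (π : S → ℝ) : Prop where
  symm : diagonal π * Q = Qᵀ * diagonal π
  weight : (diagonal π).PosSemidef
  pos : (diagonal π * Q).PosSemidef
  compl_pos : (diagonal π * (1 - Q)).PosSemidef

/-- 1 + P = 2L and 1 - P = 2(1 - L), so the forms with a = 1 and a = -1 bound the spectrum from both
sides. -/
theorem isPositiveContraction_lazyMatrix (hπ : ∀ x, 0 ≤ π x) (hP : P ∈ rowStochastic ℝ S)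
    (h : IsReversible P π) : IsPositiveContraction (lazyMatrix P) π where
  symm := by
    rw [lazyMatrix, mul_smul_comm, transpose_smul, smul_mul_assoc, mul_add, transpose_add, add_mul,
      diagonal_mul_eq_transpose_mul h, transpose_one, one_mul, mul_one]
  weight := PosSemidef.diagonal hπ
  pos := by
    have := (posSemidef_diagonal_mul_one_add_smul hπ hP h (a := 1) (by norm_num)).smul
      (a := (1 / 2 : ℝ)) (by norm_num)
    convert this using 1
    rw [lazyMatrix, mul_smul_comm, one_smul, add_comm]
  compl_pos := by
    have := (posSemidef_diagonal_mul_one_add_smul hπ hP h (a := -1) (by norm_num)).smul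
      (a := (1 / 2 : ℝ)) (by norm_num)
    convert this using 1
    rw [← mul_smul_comm, lazyMatrix]
    congr 1
    module

namespace IsPositiveContraction

variable (hQ : IsPositiveContraction Q π)
include hQ

theorem compl_symm : diagonal π * (1 - Q) = (1 - Q)ᵀ * diagonal π := by
  rw [mul_sub, transpose_sub, sub_mul, hQ.symm, transpose_one, mul_one, one_mul]

/-- Even powers are removed by congruence, which leaves exponents 0 and 1. No diagonalization is
needed. -/
theorem posSemidef_pow_mul_pow : ∀ k l : ℕ, (diagonal π * (Q ^ k * (1 - Q) ^ l)).PosSemidef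
  | 0, 0 => by simpa using hQ.weight
  | 0, 1 => by simpa using hQ.compl_pos
  | 1, 0 => by simpa using hQ.pos
  | 1, 1 => by
    -- Q(1 - Q) = Q²(1 - Q) + (1 - Q)²Q.
    have h1 := posSemidef_diagonal_mul_sq_mul hQ.symm
      ((Commute.one_right Q).sub_right (Commute.refl Q)) hQ.compl_pos
    have h2 := posSemidef_diagonal_mul_sq_mul hQ.compl_symm
      ((Commute.one_left Q).sub_left (Commute.refl Q)) hQ.pos
    convert h1.add h2 using 1
    rw [← mul_add]
    congr 1
    noncomm_ring
  | k + 2, l => by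
    have := posSemidef_diagonal_mul_sq_mul hQ.symm (X := Q ^ k * (1 - Q) ^ l)
      (((Commute.refl Q).pow_right k).mul_right
        (((Commute.one_right Q).sub_right (Commute.refl Q)).pow_right l))
      (posSemidef_pow_mul_pow k l)
    rwa [← mul_assoc (Q ^ 2), ← pow_add, add_comm 2 k] at this
  | k, l + 2 => by
    have hc : Commute (1 - Q) Q := (Commute.one_left Q).sub_left (Commute.refl Q)
    have := posSemidef_diagonal_mul_sq_mul hQ.compl_symm (X := Q ^ k * (1 - Q) ^ l)
      ((hc.pow_right k).mul_right ((Commute.refl _).pow_right l))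
      (posSemidef_pow_mul_pow k l)
    rwa [← mul_assoc ((1 - Q) ^ 2), ((hc.pow_left 2).pow_right k).eq, mul_assoc, ← pow_add,
      add_comm 2 l] at this

omit hQ in
-- A finite form of ∑ (k + 1) q^k (1 - q)² = 1, with a remainder that is nonnegative for spectrum in
-- [0,1].
theorem sum_smul_pow_mul_sq_eq (Q : Matrix S S ℝ) (n : ℕ) :
    ∑ k ∈ range n, ((k : ℝ) + 1) • (Q ^ k * (1 - Q) ^ 2) + Q ^ n + (n : ℝ) • (Q ^ n * (1 - Q)) =
      1 := by
  induction n with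
  | zero => simp
  | succ n ih =>
    rw [sum_range_succ]
    refine Eq.trans ?_ ih
    have : ((n : ℝ) + 1) • (Q ^ n * (1 - Q) ^ 2) + Q ^ (n + 1) +
        ((n + 1 : ℕ) : ℝ) • (Q ^ (n + 1) * (1 - Q)) = Q ^ n + (n : ℝ) • (Q ^ n * (1 - Q)) := by
      rw [pow_succ Q n, pow_two]
      push_cast
      simp only [mul_sub, sub_mul, mul_one, one_mul, mul_assoc]
      module
    rw [add_assoc (∑ k ∈ range n, _) (Q ^ n), ← this]
    simp only [add_assoc]

/-- The quadratic form of `M` in `L²(π)` at `f`. -/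
abbrev _root_.MarkovMixing.weightedForm (π : S → ℝ) (f : S → ℝ) (M : Matrix S S ℝ) : ℝ :=
  f ⬝ᵥ ((diagonal π * M) *ᵥ f)

theorem weightedForm_nonneg (f : S → ℝ) (k l : ℕ) :
    0 ≤ weightedForm π f (Q ^ k * (1 - Q) ^ l) := by
  simpa using (hQ.posSemidef_pow_mul_pow k l).dotProduct_mulVec_nonneg f

omit hQ in
theorem weightedForm_add (f : S → ℝ) (M N : Matrix S S ℝ) :
    weightedForm π f (M + N) = weightedForm π f M + weightedForm π f N := by
  rw [weightedForm, mul_add, add_mulVec, dotProduct_add]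

omit hQ in
theorem weightedForm_smul (f : S → ℝ) (c : ℝ) (M : Matrix S S ℝ) :
    weightedForm π f (c • M) = c * weightedForm π f M := by
  rw [weightedForm, mul_smul_comm, smul_mulVec, dotProduct_smul, smul_eq_mul]

omit hQ in
theorem weightedForm_sum {ι : Type*} (s : Finset ι) (f : S → ℝ) (M : ι → Matrix S S ℝ) :
    weightedForm π f (∑ i ∈ s, M i) = ∑ i ∈ s, weightedForm π f (M i) := by
  rw [weightedForm, mul_sum, sum_mulVec, dotProduct_sum]

theorem weightedForm_antitone (f : S → ℝ) :
    Antitone fun k : ℕ => weightedForm π f (Q ^ k * (1 - Q) ^ 2) := by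
  refine antitone_nat_of_succ_le fun k => ?_
  have : Q ^ k * (1 - Q) ^ 2 = Q ^ (k + 1) * (1 - Q) ^ 2 + Q ^ k * (1 - Q) ^ 3 := by
    rw [pow_succ Q k, pow_succ' (1 - Q) 2, mul_assoc, ← mul_add, ← add_mul, add_sub_cancel, one_mul]
  rw [this, weightedForm_add]
  linarith [hQ.weightedForm_nonneg f k 3]

/-- In the identity for n + 1, drop the remainder and bound each form below by the last one. The
weights 1, …, n + 1 sum to (n + 1)(n + 2)/2. -/
theorem weightedForm_pow_mul_sq_le (f : S → ℝ) (n : ℕ) :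
    ((n : ℝ) + 1) * (n + 2) / 2 * weightedForm π f (Q ^ n * (1 - Q) ^ 2) ≤ weightedForm π f 1 := by
  have h := congrArg (weightedForm π f) (sum_smul_pow_mul_sq_eq Q (n + 1))
  rw [weightedForm_add, weightedForm_add, weightedForm_sum, weightedForm_smul] at h
  simp only [weightedForm_smul] at h
  have h1 := hQ.weightedForm_nonneg f (n + 1) 0
  have h2 := hQ.weightedForm_nonneg f (n + 1) 1
  rw [pow_zero, mul_one] at h1
  rw [pow_one] at h2
  have h3 : ∑ k ∈ range (n + 1), ((k : ℝ) + 1) * weightedForm π f (Q ^ n * (1 - Q) ^ 2) ≤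
      ∑ k ∈ range (n + 1), ((k : ℝ) + 1) * weightedForm π f (Q ^ k * (1 - Q) ^ 2) := by
    refine sum_le_sum fun k hk => mul_le_mul_of_nonneg_left ?_ (by positivity)
    exact hQ.weightedForm_antitone f (Nat.lt_succ_iff.1 (mem_range.1 hk))
  have h4 : ∀ m : ℕ, ∑ k ∈ range m, ((k : ℝ) + 1) = (m : ℝ) * (m + 1) / 2 := fun m => by
    induction m with
    | zero => simp
    | succ m ih => rw [sum_range_succ, ih]; push_cast; ring
  rw [← sum_mul, h4] at h3
  have h5 : 0 ≤ ((n + 1 : ℕ) : ℝ) * weightedForm π f (Q ^ (n + 1) * (1 - Q)) :=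
    mul_nonneg (Nat.cast_nonneg _) h2
  have h6 : ((n + 1 : ℕ) : ℝ) * ((n + 1 : ℕ) + 1) / 2 = ((n : ℝ) + 1) * (n + 2) / 2 := by
    push_cast; ring
  rw [h6] at h3
  linarith

theorem sum_weight_mul_sq_le (f : S → ℝ) (s : ℕ) :
    ((s : ℝ) + 1) ^ 2 * ∑ x, π x * ((Q ^ s * (1 - Q)) *ᵥ f) x ^ 2 ≤ ∑ x, π x * f x ^ 2 := by
  have hsym : ∀ k : ℕ, diagonal π * Q ^ k = (Q ^ k)ᵀ * diagonal π := fun k => by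
    induction k with
    | zero => simp
    | succ k ih =>
      rw [pow_succ, ← mul_assoc, ih, mul_assoc, hQ.symm, ← mul_assoc, ← transpose_mul, ← pow_succ',
        ← pow_succ]
  set M := Q ^ s * (1 - Q) with hM
  have hMsym : diagonal π * M = Mᵀ * diagonal π := by
    have hc : Commute (1 - Q) (Q ^ s) :=
      (((Commute.one_left Q).sub_left (Commute.refl Q)).pow_right s)
    rw [hM, ← mul_assoc, hsym, mul_assoc, hQ.compl_symm, ← mul_assoc, ← transpose_mul, hc.eq]
  have hMM : M * M = Q ^ (2 * s) * (1 - Q) ^ 2 := by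
    have hc : Commute (1 - Q) (Q ^ s) :=
      (((Commute.one_left Q).sub_left (Commute.refl Q)).pow_right s)
    rw [hM, mul_assoc, ← mul_assoc (1 - Q), hc.eq, mul_assoc, ← mul_assoc, ← pow_add, two_mul,
      pow_two]
  have e1 : ∑ x, π x * (M *ᵥ f) x ^ 2 = weightedForm π f (Q ^ (2 * s) * (1 - Q) ^ 2) := by
    rw [← hMM, weightedForm, ← mul_assoc, hMsym, mul_assoc,
      ← mulVec_mulVec f Mᵀ, dotProduct_mulVec f Mᵀ, vecMul_transpose, ← mulVec_mulVec f _ M,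
      dotProduct_diagonal_mulVec]
    exact sum_congr rfl fun x _ => by ring
  have e2 : ∑ x, π x * f x ^ 2 = weightedForm π f 1 := by
    rw [weightedForm, mul_one, dotProduct_diagonal_mulVec]
    exact sum_congr rfl fun x _ => by ring
  -- The square of Q^s(1 - Q) has exponent n = 2s, where (2s + 1)(2s + 2)/2 ≥ (s + 1)².
  have h := hQ.weightedForm_pow_mul_sq_le f (2 * s)
  rw [e1, e2]
  refine le_trans (mul_le_mul_of_nonneg_right ?_ (hQ.weightedForm_nonneg f _ _)) h
  push_cast
  nlinarith [Nat.cast_nonneg (α := ℝ) s]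

theorem sum_weight_mul_abs_le (hπ : π ∈ stdSimplex ℝ S) {f : S → ℝ} (hf : ∀ x, |f x| ≤ 1) (s : ℕ) :
    ∑ x, π x * |((Q ^ s * (1 - Q)) *ᵥ f) x| ≤ 1 / (s + 1) := by
  have h := hQ.sum_weight_mul_sq_le f s
  have h1 : ∑ x, π x * f x ^ 2 ≤ 1 := by
    rw [← hπ.2]
    refine sum_le_sum fun x _ => mul_le_of_le_one_right (hπ.1 x) ?_
    rw [← sq_abs]
    exact pow_le_one₀ (abs_nonneg _) (hf x)
  have h2 := (even_two.convexOn_pow (𝕜 := ℝ)).map_sum_le (t := univ) (w := π)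
    (p := fun x => |((Q ^ s * (1 - Q)) *ᵥ f) x|) (fun x _ => hπ.1 x) hπ.2 (fun _ _ => Set.mem_univ _)
  simp only [smul_eq_mul, sq_abs] at h2
  have hs : (0 : ℝ) < s + 1 := by positivity
  rw [le_div_iff₀ hs]
  refine le_of_sq_le_sq ?_ zero_le_one
  rw [mul_pow, mul_comm]
  nlinarith [sq_nonneg ((s : ℝ) + 1)]

end IsPositiveContraction

end Reversible

attribute [local instance] Matrix.linftyOpNormedRing Matrix.linftyOpNormedAlgebra

/-! ### The row-sum norm, total variation, and positivity of lazy powers. -/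

section Norm

variable {S : Type*} [Fintype S] [DecidableEq S]

theorem linftyOpNorm_le_iff {A : Matrix S S ℝ} {r : ℝ} (hr : 0 ≤ r) :
    ‖A‖ ≤ r ↔ ∀ x, ∑ y, |A x y| ≤ r := by
  lift r to NNReal using hr
  rw [linfty_opNorm_def, NNReal.coe_le_coe, Finset.sup_le_iff]
  simp only [mem_univ, true_imp_iff, ← NNReal.coe_le_coe, NNReal.coe_sum, coe_nnnorm,
    Real.norm_eq_abs]

theorem norm_le_one_of_mem_rowStochastic {A : Matrix S S ℝ} (hA : A ∈ rowStochastic ℝ S) :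
    ‖A‖ ≤ 1 := by
  rw [linftyOpNorm_le_iff zero_le_one]
  intro x
  simp only [abs_of_nonneg (hA.1 _ _), sum_row_of_mem_rowStochastic hA, le_refl]

/-- The matrix all of whose rows are `π`. -/
def constantRows (π : S → ℝ) : Matrix S S ℝ := Matrix.of fun _ y => π y

theorem constantRows_mem_rowStochastic {π : S → ℝ} (hπ : π ∈ stdSimplex ℝ S) :
    constantRows π ∈ rowStochastic ℝ S :=
  mem_rowStochastic_iff_sum.2 ⟨fun _ y => hπ.1 y, fun _ => hπ.2⟩

theorem mul_constantRows {A : Matrix S S ℝ} (hA : A ∈ rowStochastic ℝ S) (π : S → ℝ) :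
    A * constantRows π = constantRows π := by
  ext x y
  simp only [mul_apply, constantRows, of_apply, ← sum_mul, sum_row_of_mem_rowStochastic hA, one_mul]

theorem constantRows_mul {S : Type*} [Fintype S] {A : Matrix S S ℝ} {π : S → ℝ}
    (h : vecMul π A = π) :
    constantRows π * A = constantRows π := by
  ext x y
  exact congrFun h y

/-- Total variation is half the ℓ¹ distance, whence 1/4 becomes 1/2. -/
theorem iSup_tvDist_le_iff [Nonempty S] (A : Matrix S S ℝ) (π : S → ℝ) :
    ⨆ x, tvDist (A x) π ≤ 1 / 4 ↔ ‖A - constantRows π‖ ≤ 1 / 2 := by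
  rw [ciSup_le_iff (Set.finite_range _).bddAbove, linftyOpNorm_le_iff (by norm_num)]
  refine forall_congr' fun x => ?_
  simp only [tvDist, Matrix.sub_apply, constantRows, of_apply]
  constructor <;> intro h <;> linarith

theorem lawAtIndepTime_zero (P : Matrix S S ℝ) (x : S) :
    lawAtIndepTime P (geometricLaw 0) x = (1 : Matrix S S ℝ) x := by
  ext y
  rw [lawAtIndepTime, tsum_eq_single 0]
  · simp [geometricLaw]
  · intro k hk
    simp [geometricLaw, hk]

theorem lawAtIndepTime_eq_geometricAverage [Nonempty S] {P : Matrix S S ℝ} (hP : ‖P‖ ≤ 1) {t : ℕ}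
    (ht : 1 ≤ t) (x : S) :
    lawAtIndepTime P (geometricLaw t) x = geometricAverage P (1 - 1 / (t : ℝ)) x := by
  have hT : (1 : ℝ) ≤ t := by exact_mod_cast ht
  have h0 : 0 ≤ 1 - 1 / (t : ℝ) := by rw [sub_nonneg, div_le_one] <;> linarith
  have h1 : 1 - 1 / (t : ℝ) < 1 := by
    have : 0 < 1 / (t : ℝ) := by positivity
    linarith
  have h := hasSum_geometricAverage h0 h1 hP
  ext y
  have hxy := (h.map (Pi.evalAddMonoidHom (fun _ : S => S → ℝ) x) (continuous_apply x)).map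
    (Pi.evalAddMonoidHom (fun _ : S => ℝ) y) (continuous_apply y)
  refine HasSum.tsum_eq ?_
  -- The law has no mass at time 0; dropping that term matches index k with time k + 1.
  refine (hasSum_nat_add_iff' 1).1 ?_
  have e : ∑ i ∈ range 1, geometricLaw t i * (P ^ i) x y = 0 := by
    simp [geometricLaw, show t ≠ 0 by omega]
  rw [e, sub_zero]
  have e' : (fun k => geometricLaw t (k + 1) * (P ^ (k + 1)) x y) = fun k =>
      (((1 - (1 - 1 / (t : ℝ))) * (1 - 1 / (t : ℝ)) ^ k) • P ^ (k + 1)) x y := by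
    funext k
    rw [geometricLaw, if_neg (by omega), if_neg (by omega), Matrix.smul_apply, smul_eq_mul,
      Nat.add_sub_cancel]
    ring
  rw [e']
  exact hxy

theorem geometricDist_le_iff [Nonempty S] {P : Matrix S S ℝ} (hP : ‖P‖ ≤ 1) (π : S → ℝ) {t : ℕ}
    (ht : 1 ≤ t) :
    geometricDist P π t ≤ 1 / 4 ↔
      ‖geometricAverage P (1 - 1 / (t : ℝ)) - constantRows π‖ ≤ 1 / 2 := by
  rw [← iSup_tvDist_le_iff, geometricDist]
  simp only [lawAtIndepTime_eq_geometricAverage hP ht]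

theorem geometricDist_zero (P : Matrix S S ℝ) (π : S → ℝ) :
    geometricDist P π 0 = lazyDist P π 0 := by
  simp only [geometricDist, lazyDist, lawAtIndepTime_zero, pow_zero]

theorem lazyDist_le_iff [Nonempty S] (P : Matrix S S ℝ) (π : S → ℝ) (t : ℕ) :
    lazyDist P π t ≤ 1 / 4 ↔ ‖lazyVersion P ^ t - constantRows π‖ ≤ 1 / 2 := by
  rw [← iSup_tvDist_le_iff]
  rfl

theorem lazyVersion_mem_rowStochastic {P : Matrix S S ℝ} (hP : P ∈ rowStochastic ℝ S) :
    lazyVersion P ∈ rowStochastic ℝ S := by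
  have := convex_rowStochastic (R := ℝ) (n := S) hP (one_mem (rowStochastic ℝ S))
    (a := 1 / 2) (b := 1 / 2) (by norm_num) (by norm_num) (by norm_num)
  rwa [← smul_add] at this

theorem abs_mulVec_le {A : Matrix S S ℝ} {f : S → ℝ} {a b : ℝ} (hA : ‖A‖ ≤ a)
    (hf : ∀ x, |f x| ≤ b) (hb : 0 ≤ b) (x : S) : |(A *ᵥ f) x| ≤ a * b := by
  have hf' : ‖f‖ ≤ b := (pi_norm_le_iff_of_nonneg hb).2 hf
  exact (norm_le_pi_norm (A *ᵥ f) x).trans ((linfty_opNorm_mulVec A f).trans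
    (mul_le_mul hA hf' (norm_nonneg _) ((norm_nonneg _).trans hA)))

/-- Some power of the lazy version of an irreducible matrix is positive. -/
theorem exists_pow_lazyVersion_pos {P : Matrix S S ℝ} (hP : P ∈ rowStochastic ℝ S)
    (h : P.IsIrreducible) : ∃ n : ℕ, ∀ x y, 0 < (lazyVersion P ^ n) x y := by
  have hL := lazyVersion_mem_rowStochastic hP
  have hmono : ∀ (n k : ℕ) (x y : S), 0 < (lazyVersion P ^ n) x y →
      0 < (lazyVersion P ^ (n + k)) x y := fun n k x y hn => by
    induction k with
    | zero => exact hn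
    | succ k ih =>
      rw [← add_assoc, pow_succ, mul_apply]
      refine lt_of_lt_of_le (mul_pos ih (?_ : 0 < lazyVersion P y y)) (single_le_sum
        (f := fun z => (lazyVersion P ^ (n + k)) x z * lazyVersion P z y)
        (fun z _ => mul_nonneg ((pow_mem hL _).1 x z) (hL.1 z y)) (mem_univ y))
      have := hP.1 y y
      simp only [lazyVersion, Matrix.smul_apply, Matrix.add_apply, one_apply_eq, smul_eq_mul]
      linarith
  have hpow : ∀ (k : ℕ) (x y : S), (1 / 2 : ℝ) ^ k * (P ^ k) x y ≤ (lazyVersion P ^ k) x y := by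
    intro k
    induction k with
    | zero => simp
    | succ k ih =>
      intro x y
      rw [pow_succ, pow_succ P, pow_succ (lazyVersion P), mul_apply, mul_apply, mul_sum]
      refine sum_le_sum fun z _ => ?_
      have h1 : 1 / 2 * P z y ≤ lazyVersion P z y := by
        simp only [lazyVersion, Matrix.smul_apply, Matrix.add_apply, smul_eq_mul, one_apply]
        split_ifs <;> linarith
      calc _ = ((1 / 2) ^ k * (P ^ k) x z) * (1 / 2 * P z y) := by ring
        _ ≤ _ := mul_le_mul (ih x z) h1 (mul_nonneg (by norm_num) (hP.1 z y))
            ((pow_mem hL k).1 x z)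
  have hex := (isIrreducible_iff_exists_pow_pos hP.1).1 h
  choose n hn0 hn using hex
  -- A common time for all pairs: holding probabilities are at least 1/2, so positivity persists at
  -- later times.
  refine ⟨∑ x, ∑ y, n x y, fun x y => ?_⟩
  have hle : n x y ≤ ∑ x, ∑ y, n x y :=
    (single_le_sum (f := fun y => n x y) (fun _ _ => Nat.zero_le _) (mem_univ y)).trans
      (single_le_sum (f := fun x => ∑ y, n x y) (fun _ _ => Nat.zero_le _) (mem_univ x))
  rw [← Nat.add_sub_cancel' hle]
  exact hmono _ _ _ _ (lt_of_lt_of_le (mul_pos (by positivity) (hn x y)) (hpow _ x y))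

end Norm

/-! ### From a random time to a fixed time, and the comparison of mixing times. -/

section Mixing

variable {S : Type*} [Fintype S] [DecidableEq S] [Nonempty S] {π : S → ℝ} {P Q : Matrix S S ℝ}

/-- For a reversible chain with nonnegative spectrum, mixing at an independent random time bounded
by `K` forces mixing at any fixed time much larger than `K`. -/
theorem norm_pow_sub_constantRows_le (hQ : IsPositiveContraction Q π) (hQs : Q ∈ rowStochastic ℝ S)
    (hπ : π ∈ stdSimplex ℝ S) (hst : constantRows π * Q = constantRows π) {q : Polynomial ℝ}
    (hq0 : ∀ k, 0 ≤ q.coeff k) (hq1 : q.eval 1 = 1) {K m : ℕ} (hqK : q.natDegree ≤ K) (hm : K ≤ m)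
    {ε : ℝ} (hε : ‖Polynomial.aeval Q q - constantRows π‖ ≤ ε) :
    ‖Q ^ m - constantRows π‖ ≤ 3 * ε + K / ((m - K : ℕ) + 1 : ℝ) := by
  have hε0 : 0 ≤ ε := (norm_nonneg _).trans hε
  rw [linftyOpNorm_le_iff (by positivity)]
  intro x
  have hQn : ‖Q‖ ≤ 1 := norm_le_one_of_mem_rowStochastic hQs
  have hpow : ∀ k : ℕ, ∀ v : S → ℝ, (∀ y, |v y| ≤ 1) → ∀ y, |(Q ^ k *ᵥ v) y| ≤ 1 :=
    fun k v hv y => by simpa using abs_mulVec_le (norm_pow_le_one hQn k) hv zero_le_one y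
  set p := constantRows π with hp
  set A := Polynomial.aeval Q q with hA
  have hAe : A = ∑ k ∈ range (K + 1), q.coeff k • Q ^ k :=
    Polynomial.aeval_eq_sum_range' (Nat.lt_succ_of_le hqK) Q
  have hw1 : ∑ k ∈ range (K + 1), q.coeff k = 1 := by
    rw [← hq1, Polynomial.eval_eq_sum_range' (Nat.lt_succ_of_le hqK)]
    simp
  have hAv : ∀ v : S → ℝ, (A *ᵥ v) x = ∑ k ∈ range (K + 1), q.coeff k * (Q ^ k *ᵥ v) x := by
    intro v
    rw [hAe, sum_mulVec, Finset.sum_apply]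
    simp only [smul_mulVec, Pi.smul_apply, smul_eq_mul]
  have hpv : ∀ v : S → ℝ, (p *ᵥ v) x = ∑ y, π y * v y := fun v => rfl
  -- Duality: testing against the signs of row x recovers its ℓ¹ norm.
  set f : S → ℝ := fun y => SignType.sign ((Q ^ m - p) x y) with hf
  have hf1 : ∀ y, |f y| ≤ 1 := fun y => by
    simp only [hf]
    rcases SignType.sign ((Q ^ m - p) x y) with _ | _ | _ <;> simp
  have hsum : ∑ y, |(Q ^ m - p) x y| = (Q ^ m *ᵥ f) x - (p *ᵥ f) x := by
    rw [← Pi.sub_apply, ← sub_mulVec, mulVec, dotProduct]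
    exact sum_congr rfl fun y _ => (self_mul_sign _).symm
  set g := Q ^ m *ᵥ f with hg
  have hg1 : ∀ y, |g y| ≤ 1 := hpow m f hf1
  have hpg : p *ᵥ f = p *ᵥ g := by
    have : ∀ k : ℕ, p * Q ^ k = p := fun k => by
      induction k with
      | zero => simp
      | succ k ih => rw [pow_succ, ← mul_assoc, ih, hst]
    rw [hg, mulVec_mulVec, this]
  set D : S → ℝ := fun y => ∑ s ∈ Ico (m - K) m, |((Q ^ s * (1 - Q)) *ᵥ f) y| with hD
  -- D bounds the change of Q^(m - k) f over all k ≤ K. The cap 2 is free, as both functions are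
  -- bounded by 1, and it makes replacing A by p on M cost at most 2ε.
  set M : S → ℝ := fun y => min (D y) 2 with hM
  have hD0 : ∀ y, 0 ≤ D y := fun y => sum_nonneg fun _ _ => abs_nonneg _
  have hM2 : ∀ y, |M y| ≤ 2 := fun y => by
    rw [abs_of_nonneg (le_min (hD0 y) (by norm_num))]
    exact min_le_right _ _
  have hdiff : ∀ k ≤ K, ∀ y, |(Q ^ (m - k) *ᵥ f) y - g y| ≤ M y := by
    intro k hk y
    refine le_min ?_ ?_
    · have e : Q ^ (m - k) - Q ^ m = ∑ s ∈ Ico (m - k) m, Q ^ s * (1 - Q) := by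
        have := sum_Ico_sub (fun s => Q ^ s) (Nat.sub_le m k)
        rw [← neg_sub, ← this, ← sum_neg_distrib]
        exact sum_congr rfl fun s _ => by rw [pow_succ, mul_sub, mul_one, neg_sub]
      rw [hg, ← Pi.sub_apply, ← sub_mulVec, e, sum_mulVec, Finset.sum_apply]
      refine (abs_sum_le_sum_abs _ _).trans ?_
      exact sum_le_sum_of_subset_of_nonneg (Ico_subset_Ico_left (by omega))
        fun _ _ _ => abs_nonneg _
    · refine (abs_sub _ _).trans ?_
      linarith [hpow (m - k) f hf1 y, hg1 y]
  -- Write g = Q^k Q^(m - k) f, average over k with the weights of q, and replace Q^(m - k) f by g.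
  have h1 : g x - (A *ᵥ g) x ≤ (A *ᵥ M) x := by
    have e : g x = ∑ k ∈ range (K + 1), q.coeff k * (Q ^ k *ᵥ (Q ^ (m - k) *ᵥ f)) x := by
      have : ∀ k ∈ range (K + 1), q.coeff k * (Q ^ k *ᵥ (Q ^ (m - k) *ᵥ f)) x =
          q.coeff k * g x := fun k hk => by
        rw [mulVec_mulVec, ← pow_add, Nat.add_sub_cancel']
        exact (Nat.lt_succ_iff.1 (mem_range.1 hk)).trans hm
      rw [sum_congr rfl this, ← sum_mul, hw1, one_mul]
    rw [hAv, hAv, e, ← sum_sub_distrib]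
    refine sum_le_sum fun k hk => ?_
    rw [← mul_sub, ← Pi.sub_apply, ← mulVec_sub]
    refine mul_le_mul_of_nonneg_left ?_ (hq0 k)
    refine sum_le_sum fun y _ => mul_le_mul_of_nonneg_left ?_ ((pow_mem hQs k).1 x y)
    exact (le_abs_self _).trans (hdiff k (Nat.lt_succ_iff.1 (mem_range.1 hk)) y)
  have h2 : (A *ᵥ g) x - (p *ᵥ g) x ≤ ε := by
    have := abs_mulVec_le hε hg1 zero_le_one x
    rw [sub_mulVec, Pi.sub_apply, mul_one] at this
    exact (le_abs_self _).trans this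
  have h3 : (A *ᵥ M) x - (p *ᵥ M) x ≤ ε * 2 := by
    have := abs_mulVec_le hε hM2 zero_le_two x
    rw [sub_mulVec, Pi.sub_apply] at this
    exact (le_abs_self _).trans this
  have h4 : (p *ᵥ M) x ≤ K / ((m - K : ℕ) + 1 : ℝ) := by
    rw [hpv]
    calc ∑ y, π y * M y ≤ ∑ y, π y * D y :=
          sum_le_sum fun y _ => mul_le_mul_of_nonneg_left (min_le_left _ _) (hπ.1 y)
      _ = ∑ s ∈ Ico (m - K) m, ∑ y, π y * |((Q ^ s * (1 - Q)) *ᵥ f) y| := by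
          simp only [hD, mul_sum]
          exact sum_comm
      _ ≤ ∑ s ∈ Ico (m - K) m, 1 / ((m - K : ℕ) + 1 : ℝ) := by
          refine sum_le_sum fun s hs => (hQ.sum_weight_mul_abs_le hπ hf1 s).trans ?_
          have : ((m - K : ℕ) : ℝ) ≤ s := Nat.cast_le.2 (mem_Ico.1 hs).1
          gcongr
      _ = _ := by
          rw [sum_const, Nat.card_Ico, Nat.sub_sub_self hm, nsmul_eq_mul, mul_one_div]
  rw [hsum, hpg]
  linarith

/-- Doeblin's argument: a positive power dominates δp, where δ is its least entry, and the remainder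
has row sums 1 - δ. -/
theorem exists_norm_pow_lazyVersion_sub_le (hP : P ∈ rowStochastic ℝ S) (h : P.IsIrreducible)
    (hπ : π ∈ stdSimplex ℝ S) (hst : constantRows π * P = constantRows π) :
    ∃ t : ℕ, ‖lazyVersion P ^ t - constantRows π‖ ≤ 1 / 2 := by
  obtain ⟨n, hn⟩ := exists_pow_lazyVersion_pos hP h
  have hL := pow_mem (lazyVersion_mem_rowStochastic hP) n
  have hp := constantRows_mem_rowStochastic hπ
  set M := lazyVersion P ^ n with hM
  obtain ⟨z, hz⟩ := Finite.exists_min fun z : S × S => M z.1 z.2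
  set δ := M z.1 z.2 with hδ
  have hδ0 : 0 < δ := hn _ _
  have hδ1 : δ ≤ 1 := le_one_of_mem_rowStochastic hL
  have hE : ‖M - δ • constantRows π‖ ≤ 1 - δ := by
    rw [linftyOpNorm_le_iff (by linarith)]
    intro x
    have : ∀ y, |(M - δ • constantRows π) x y| = M x y - δ * constantRows π x y := fun y => by
      refine abs_of_nonneg ?_
      have h1 := hz (x, y)
      have h2 : constantRows π x y ≤ 1 := le_one_of_mem_rowStochastic hp
      simp only [Matrix.sub_apply, Matrix.smul_apply, smul_eq_mul] at h1 ⊢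
      nlinarith
    simp only [this, sum_sub_distrib, ← mul_sum, sum_row_of_mem_rowStochastic hL,
      sum_row_of_mem_rowStochastic hp, mul_one, le_refl]
  have hpM : constantRows π * M = constantRows π := by
    rw [hM]
    clear * - hst
    induction n with
    | zero => simp
    | succ k ih => rw [pow_succ, ← mul_assoc, ih, mul_lazyVersion hst]
  have hlim := (tendsto_pow_atTop_nhds_zero_of_lt_one (r := 1 - δ) (by linarith)
    (by linarith)).eventually_lt_const (show (0 : ℝ) < 1 / 4 by norm_num)
  obtain ⟨j, hj⟩ := hlim.exists
  refine ⟨n * j, ?_⟩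
  rw [pow_mul]
  refine (norm_pow_sub_le (mul_constantRows hp π) (mul_constantRows hL π) hpM
    (E := M - δ • constantRows π) (b := δ) (by abel)
    (norm_le_one_of_mem_rowStochastic hp) j).trans ?_
  linarith [pow_le_pow_left₀ (norm_nonneg _) hE j]

/-- Existence of the two mixing times, together with the two comparisons. -/
theorem mixingTimes_comparison (hc : IsIrreducibleChain P π) (hr : IsReversible P π) :
    (∃ t : ℕ, lazyDist P π t ≤ 1 / 4) ∧ (∃ t : ℕ, geometricDist P π t ≤ 1 / 4) ∧
      geometricMixingTime P π ≤ 33 * lazyMixingTime P π ∧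
      lazyMixingTime P π ≤ 1000 * geometricMixingTime P π := by
  have hPs := hc.stochastic
  have hπ := hc.isProb
  have hps := constantRows_mem_rowStochastic hπ
  have hPn := norm_le_one_of_mem_rowStochastic hPs
  have hpn := norm_le_one_of_mem_rowStochastic hps
  have hpp := mul_constantRows hps π
  have hPp := mul_constantRows hPs π
  have hpP := constantRows_mul hc.stationary
  have easy : ∀ t : ℕ, lazyDist P π t ≤ 1 / 4 →
      ∃ T : ℕ, T ≤ 33 * t ∧ geometricDist P π T ≤ 1 / 4 := by
    intro t ht
    -- Time 0 is separate: both laws are then the unit mass at the start. For t ≥ 1, 32t + 1 ≤ 33t.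
    rcases Nat.eq_zero_or_pos t with rfl | h0
    · exact ⟨0, le_rfl, by rwa [geometricDist_zero]⟩
    · refine ⟨32 * t + 1, by omega, ?_⟩
      rw [geometricDist_le_iff hPn π (by omega)]
      exact norm_geometricAverage_sub_le hPn hpn hpp hPp hpP h0 ((lazyDist_le_iff P π t).1 ht)
  have hard : ∀ t : ℕ, geometricDist P π t ≤ 1 / 4 → lazyDist P π (1000 * t) ≤ 1 / 4 := by
    intro t ht
    rcases Nat.eq_zero_or_pos t with rfl | h0
    · rwa [geometricDist_zero] at ht
    · obtain ⟨q, hq0, hq1, hqK, hq⟩ := exists_polynomial_norm_aeval_lazyVersion_sub_le hPn hpn hpp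
        hPp hpP h0 ((geometricDist_le_iff hPn π h0).1 ht)
      rw [lazyDist_le_iff]
      refine (norm_pow_sub_constantRows_le (isPositiveContraction_lazyMatrix hπ.1 hPs hr)
        (lazyVersion_mem_rowStochastic hPs) hπ (mul_lazyVersion hpP) hq0 hq1 hqK
        (m := 1000 * t) (by omega) hq).trans ?_
      -- Half of the budget 1/2; the other half is 3ε with ε = 1/12.
      have h1 : ((200 * t : ℕ) : ℝ) / ((1000 * t - 200 * t : ℕ) + 1 : ℝ) ≤ 1 / 4 := by
        rw [show 1000 * t - 200 * t = 800 * t by omega, div_le_iff₀ (by positivity)]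
        push_cast
        linarith
      linarith
  obtain ⟨t, ht⟩ := exists_norm_pow_lazyVersion_sub_le hPs hc.irreducible hπ hpP
  have hexL : ∃ t : ℕ, lazyDist P π t ≤ 1 / 4 := ⟨t, (lazyDist_le_iff P π t).2 ht⟩
  have hexG : ∃ t : ℕ, geometricDist P π t ≤ 1 / 4 := by
    obtain ⟨T, -, hT⟩ := easy _ hexL.choose_spec
    exact ⟨T, hT⟩
  refine ⟨hexL, hexG, ?_, ?_⟩
  · obtain ⟨T, hT, hTd⟩ := easy _ (Nat.sInf_mem (s := {t | lazyDist P π t ≤ 1 / 4}) hexL)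
    exact (Nat.sInf_le (s := {t | geometricDist P π t ≤ 1 / 4}) hTd).trans hT
  · exact Nat.sInf_le (s := {t | lazyDist P π t ≤ 1 / 4})
      (hard _ (Nat.sInf_mem (s := {t | geometricDist P π t ≤ 1 / 4}) hexG))

end Mixing

end MarkovMixing

theorem mainTheorem4 :
    ∃ c c' : ℝ, 0 < c ∧ 0 < c' ∧
      ∀ (S : Type*) [Fintype S] [DecidableEq S] (P : Matrix S S ℝ) (π : S → ℝ),
        MarkovMixing.IsIrreducibleChain P π → MarkovMixing.IsReversible P π →
          (∃ t : ℕ, MarkovMixing.lazyDist P π t ≤ 1 / 4) ∧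
          (∃ t : ℕ, MarkovMixing.geometricDist P π t ≤ 1 / 4) ∧
          c * (MarkovMixing.geometricMixingTime P π : ℝ) ≤ MarkovMixing.lazyMixingTime P π ∧
          (MarkovMixing.lazyMixingTime P π : ℝ) ≤ c' * MarkovMixing.geometricMixingTime P π := by
  refine ⟨1 / 33, 1000, by norm_num, by norm_num, fun S _ _ P π hc hr => ?_⟩
  -- On an empty space the total mass of π would be 0.
  have : Nonempty S := by
    by_contra h
    rw [not_nonempty_iff] at h
    simpa using hc.isProb.2
  obtain ⟨h1, h2, h3, h4⟩ := MarkovMixing.mixingTimes_comparison hc hr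
  refine ⟨h1, h2, ?_, by exact_mod_cast h4⟩
  have : (MarkovMixing.geometricMixingTime P π : ℝ) ≤ 33 * MarkovMixing.lazyMixingTime P π := by
    exact_mod_cast h3
  linarith
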